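/- Let $1\le p<\infty$ and let $X$ be a (real or complex) Banach space, with dual $X^*$. A sequence $(x_n)$ in $X$ is weakly $p$-summable if $(x^*(x_n))_n\in\ell_p$ for every $x^*\in X^*$. An operator (continuous linear map) $T:X\to Y$ into a Banach space $Y$ is $p$-convergent if $\|T(x_n)\|\to 0$ for every weakly $p$-summable sequence $(x_n)$ in $X$. A bounded set $A\subseteq X^*$ is a weakly-$p$-$L$-set if $\sup_{x^*\in A}|x^*(x_n)|\to 0$ for every weakly $p$-summable sequence $(x_n)$ in $X$. A subset of a Banach space is weakly precompact if each of its sequences has a weakly Cauchy subsequence. An operator is called weakly precompact, weakly compact, or compact if the image of the closed unit ball is weakly precompact, relatively weakly compact, or relatively norm compact, respectively. The space $X$ has property $RDP_p$ if every weakly-$p$-$L$-subset of $X^*$ is relatively weakly compact. \textbf{Theorem.} (a) The following are equivalent: (i) for every Banach space $Y$ and every $p$-convergent operator $T:X\to Y$, the adjoint $T^*:Y^*\to X^*$ is weakly precompact; (ii) for every $p$-convergent operator $T:X\to\ell_\infty$, the adjoint $T^*:\ell_\infty^*\to X^*$ is weakly precompact; (iii) every weakly-$p$-$L$-subset of $X^*$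 is weakly precompact. (b) The three statements obtained from (i), (ii), (iii) by replacing "weakly precompact" with "weakly compact" in (i) and (ii) and with "relatively weakly compact" in (iii) are equivalent. (c) The three statements obtained from (i), (ii), (iii) by replacing "weakly precompact" with "compact" in (i) and (ii) and with "relatively compact" in (iii) are equivalent. (d) In particular, $X$ has property $RDP_p$ if and only if, for every Banach space $Y$, every $p$-convergent operator $T:X\to Y$ is weakly compact. -/

import Mathlib

open Filter Topology
open scoped ENNReal

universe u v

section WeakNotions

variable {𝕜 : Type*} [RCLike 𝕜]
variable {E : Type*} [NormedAddCommGroup E] [NormedSpace 𝕜 E]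
variable {F : Type*} [NormedAddCommGroup F] [NormedSpace 𝕜 F]

variable (𝕜) in
/-- The sequence `x` is weakly Cauchy: `f (x n)` is a Cauchy sequence of scalars for every
continuous linear functional `f`. -/
def IsWeaklyCauchySeq (x : ℕ → E) : Prop :=
  ∀ f : StrongDual 𝕜 E, CauchySeq fun n => f (x n)

variable (𝕜) in
/-- Every sequence in `S` has a weakly Cauchy subsequence. -/
def IsWeaklyPrecompact (S : Set E) : Prop :=
  ∀ x : ℕ → E, (∀ n, x n ∈ S) →
    ∃ φ : ℕ → ℕ, StrictMono φ ∧ IsWeaklyCauchySeq 𝕜 fun n => x (φ n)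

variable (𝕜) in
/-- The closure of `S` in the weak topology is compact in the weak topology. -/
def IsRelWeaklyCompact (S : Set E) : Prop :=
  IsCompact (closure (toWeakSpace 𝕜 E '' S))

/-- The norm closure of `S` is norm compact. -/
def IsRelCompact (S : Set E) : Prop :=
  IsCompact (closure S)

/-- The image of the closed unit ball is weakly precompact. -/
def IsWeaklyPrecompactOperator (T : E →L[𝕜] F) : Prop :=
  IsWeaklyPrecompact 𝕜 (T '' Metric.closedBall (0 : E) 1)

/-- The image of the closed unit ball is relatively weakly compact. -/
def IsWeaklyCompactOperator (T : E →L[𝕜] F) : Prop :=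
  IsRelWeaklyCompact 𝕜 (T '' Metric.closedBall (0 : E) 1)

/-- The Banach space adjoint `T* : F* → E*`, `g ↦ g ∘ T`. -/
noncomputable def banachAdjoint (T : E →L[𝕜] F) : StrongDual 𝕜 F →L[𝕜] StrongDual 𝕜 E :=
  (ContinuousLinearMap.compL 𝕜 E F 𝕜).flip T

theorem banachAdjoint_apply (T : E →L[𝕜] F) (g : StrongDual 𝕜 F) (x : E) :
    banachAdjoint T g x = g (T x) := rfl

variable (𝕜) in
/-- The scalar sequence `f (x n)` belongs to `ℓ_p` for every continuous linear functional `f`. -/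
def IsWeaklyPSummable (p : ℝ≥0∞) (x : ℕ → E) : Prop :=
  ∀ f : StrongDual 𝕜 E, Memℓp (fun n => f (x n)) p

/-- `T` maps weakly `p`-summable sequences to norm null sequences. -/
def IsPConvergent (p : ℝ≥0∞) (T : E →L[𝕜] F) : Prop :=
  ∀ x : ℕ → E, IsWeaklyPSummable 𝕜 p x → Tendsto (fun n => T (x n)) atTop (𝓝 0)

/-- A bounded subset `A` of the dual of `E` such that `sup_{f ∈ A} |f (x n)| → 0` for every weakly
`p`-summable sequence `x` in `E`. (The supremum is finite because `A` is bounded, and it is `0`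
when `A` is empty.) -/
def IsWeaklyPLSet (p : ℝ≥0∞) (A : Set (StrongDual 𝕜 E)) : Prop :=
  Bornology.IsBounded A ∧
    ∀ x : ℕ → E, IsWeaklyPSummable 𝕜 p x →
      Tendsto (fun n => ⨆ f : A, ‖(f : StrongDual 𝕜 E) (x n)‖) atTop (𝓝 0)

variable (𝕜 E) in
/-- The reciprocal Dunford-Pettis property of order `p`: every weakly-`p`-`L`-subset of the dual
of `E` is relatively weakly compact. -/
def HasRDP (p : ℝ≥0∞) : Prop :=
  ∀ A : Set (StrongDual 𝕜 E), IsWeaklyPLSet p A → IsRelWeaklyCompact 𝕜 A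

end WeakNotions

/-!
For a `p`-convergent operator `T : X → Y` the image under `T*` of the unit ball of `Y*` is a
weakly-`p`-`L`-set, since `|(T* g) x| ≤ ‖T x‖` (`IsPConvergent.isWeaklyPLSet`). Conversely, a
sequence `f` in a weakly-`p`-`L`-set gives a `p`-convergent operator `x ↦ (f k x)ₖ` into `ℓ_∞`,
whose adjoint maps the coordinate functionals to the terms of `f` (`lpInftyOfBounded`). Hence a
property of sets that passes to subsets and is determined by sequences holds for all
weakly-`p`-`L`-sets as soon as it holds for all images `T* (ball)` with `T` a `p`-convergent
operator into `ℓ_∞` (`tfae_weaklyPLSet`).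

Weak precompactness and relative norm compactness are determined by sequences for elementary
reasons. For relative weak compactness this is Eberlein's theorem
(`isRelWeaklyCompact_of_mapClusterPt`), proved by Whitley's argument: a weak-star limit point `φ`
of the set in the bidual is approximated by a sequence of the set on enough functionals to norm
the span of `φ` and the sequence, so that `φ` must agree with a weak cluster point of the
sequence.

The reciprocal Dunford-Pettis property of order `p` is the last statement of the weakly compact
case, and Gantmacher's theorem (`IsWeaklyCompactOperator.banachAdjoint`,
`IsWeaklyCompactOperator.of_banachAdjoint`) passes between `T*` and `T`. Gantmacher's theorem
follows from Goldstine's theorem (`goldstine`), which controls the values of `T**` on the bidual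
by those of `T` on the space.
-/

/-! ### Goldstine's theorem -/

section Goldstine

variable {𝕜 : Type*} [RCLike 𝕜] {E : Type*} [NormedAddCommGroup E] [NormedSpace 𝕜 E]

open NormedSpace Metric

theorem StrongDual.norm_le_of_forall_re_le {g : StrongDual 𝕜 E} {u : ℝ}
    (h : ∀ x ∈ closedBall (0 : E) 1, RCLike.re (g x) ≤ u) : ‖g‖ ≤ u := by
  have hu : 0 ≤ u := by simpa using h 0 (by simp)
  refine ContinuousLinearMap.opNorm_le_of_unit_norm hu fun x hx => ?_
  obtain ⟨c, hc, hcg⟩ := RCLike.exists_norm_eq_mul_self (g x)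
  have := h (c • x) (by simp [norm_smul, hc, hx])
  rwa [map_smul, smul_eq_mul, ← hcg, RCLike.ofReal_re] at this

/-- Hahn-Banach separation of a point from the closed image of the unit ball. Only the `𝕜`-structure
of `W` enters the statement, so that it applies to `WeakDual` without reference to a real structure
there. -/
theorem exists_dual_separating_closure_image_closedBall {W ι : Type*} [AddCommGroup W]
    [Module 𝕜 W] [TopologicalSpace W] [IsTopologicalAddGroup W] [ContinuousSMul 𝕜 W]
    {p : SeminormFamily 𝕜 W ι} (hp : WithSeminorms p) (L : E →ₗ[𝕜] W) {w : W}
    (hw : w ∉ closure (L '' closedBall 0 1)) :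
    ∃ (f : StrongDual 𝕜 W) (u : ℝ),
      (∀ x ∈ closedBall (0 : E) 1, RCLike.re (f (L x)) ≤ u) ∧ u < RCLike.re (f w) := by
  let : NormedSpace ℝ E := NormedSpace.restrictScalars ℝ 𝕜 E
  let : Module ℝ W := Module.compHom W (algebraMap ℝ 𝕜)
  have : IsScalarTower ℝ 𝕜 W := IsScalarTower.of_compHom ℝ 𝕜 W
  have : ContinuousSMul ℝ W := IsScalarTower.continuousSMul 𝕜
  have : LocallyConvexSpace ℝ W := hp.toLocallyConvexSpace
  have hconv : Convex ℝ (L '' closedBall 0 1) :=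
    (convex_closedBall (0 : E) 1).linear_image (L.restrictScalars ℝ)
  obtain ⟨f, u, hfu, huf⟩ :=
    RCLike.geometric_hahn_banach_closed_point (𝕜 := 𝕜) hconv.closure isClosed_closure hw
  exact ⟨f, u, fun x hx => (hfu _ (subset_closure ⟨x, hx, rfl⟩)).le, huf⟩

theorem WeakDual.exists_eq_eval (f : StrongDual 𝕜 (WeakDual 𝕜 E)) :
    ∃ x : E, ∀ ψ : WeakDual 𝕜 E, f ψ = ψ x := by
  obtain ⟨x, hx⟩ := LinearMap.dualEmbedding_surjective (topDualPairing 𝕜 E)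
    { toFun := f, map_add' := map_add f, map_smul' := map_smul f, cont := f.continuous }
  exact ⟨x, fun ψ => (DFunLike.congr_fun hx ψ).symm⟩

/-- **Goldstine's theorem**: the unit ball of a normed space is weak-star dense in the unit ball
of its bidual. -/
theorem goldstine {φ : StrongDual 𝕜 (StrongDual 𝕜 E)} (hφ : ‖φ‖ ≤ 1) :
    StrongDual.toWeakDual φ ∈
      closure (inclusionInDoubleDualWeak 𝕜 E '' (toWeakSpace 𝕜 E '' closedBall 0 1)) := by
  by_contra hmem
  rw [Set.image_image] at hmem
  obtain ⟨f, u, hfu, huf⟩ := exists_dual_separating_closure_image_closedBall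
    (WeakDual.withSeminorms 𝕜 (StrongDual 𝕜 E))
    ((inclusionInDoubleDualWeak 𝕜 E).toLinearMap ∘ₗ (toWeakSpace 𝕜 E).toLinearMap) hmem
  -- a weak-star continuous functional on the bidual is the evaluation at some `g`
  obtain ⟨g, hfg⟩ := WeakDual.exists_eq_eval f
  have hgu : ‖g‖ ≤ u := StrongDual.norm_le_of_forall_re_le fun x hx => by
    have := hfu x hx
    rwa [hfg] at this
  rw [hfg] at huf
  have : RCLike.re (φ g) ≤ ‖g‖ := (RCLike.re_le_norm _).trans <|
    (φ.le_opNorm g).trans <| mul_le_of_le_one_left (norm_nonneg _) hφ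
  exact absurd huf (not_lt.2 (this.trans hgu))

end Goldstine

/-! ### Gantmacher's theorem -/

section Gantmacher

variable {𝕜 : Type*} [RCLike 𝕜] {E : Type*} [NormedAddCommGroup E] [NormedSpace 𝕜 E]
variable {F : Type*} [NormedAddCommGroup F] [NormedSpace 𝕜 F]

open NormedSpace Metric

theorem IsRelWeaklyCompact.closure_image_inclusion_subset {S : Set E}
    (hS : IsRelWeaklyCompact 𝕜 S) :
    closure (inclusionInDoubleDualWeak 𝕜 E '' (toWeakSpace 𝕜 E '' S)) ⊆
      inclusionInDoubleDualWeak 𝕜 E '' closure (toWeakSpace 𝕜 E '' S) :=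
  closure_minimal (Set.image_mono subset_closure)
    (IsCompact.image hS (inclusionInDoubleDualWeak 𝕜 E).continuous).isClosed

theorem WeakDual.toStrongDual_mem_closedBall {g : WeakDual 𝕜 E} {r : ℝ} :
    g ∈ WeakDual.toStrongDual ⁻¹' closedBall (0 : StrongDual 𝕜 E) r ↔
      ‖WeakDual.toStrongDual g‖ ≤ r :=
  mem_closedBall_zero_iff

/-- A complete subspace is weakly closed. -/
theorem LinearIsometry.isClosed_toWeakSpace_image_range [CompleteSpace E] (J : E →ₗᵢ[𝕜] F) :
    IsClosed (toWeakSpace 𝕜 F '' Set.range J) := by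
  let : NormedSpace ℝ F := NormedSpace.restrictScalars ℝ 𝕜 F
  have hconv : Convex ℝ (Set.range J) :=
    (J.toLinearMap.range.restrictScalars ℝ).convex
  rw [← J.isometry.isClosedEmbedding.isClosed_range.closure_eq, hconv.toWeakSpace_closure 𝕜]
  exact isClosed_closure

theorem exists_norm_le_one_smul_eq (x : E) : ∃ (c : 𝕜) (y : E), ‖y‖ ≤ 1 ∧ c • y = x := by
  rcases eq_or_ne x 0 with rfl | hx
  · exact ⟨0, 0, by simp, by simp⟩
  · have hx' : ((‖x‖ : ℝ) : 𝕜) ≠ 0 := by simpa using hx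
    refine ⟨(‖x‖ : 𝕜), (‖x‖ : 𝕜)⁻¹ • x, ?_, by rw [smul_smul, mul_inv_cancel₀ hx', one_smul]⟩
    rw [norm_smul, norm_inv, RCLike.norm_ofReal, abs_norm, inv_mul_cancel₀ (norm_ne_zero_iff.2 hx)]

theorem continuous_toWeakDual_banachAdjoint (T : E →L[𝕜] F) :
    Continuous fun g : WeakDual 𝕜 F =>
      StrongDual.toWeakDual (banachAdjoint T (WeakDual.toStrongDual g)) :=
  WeakDual.continuous_of_continuous_eval fun x => WeakDual.eval_continuous (T x)

/-- The bidual map of a weakly compact operator takes values in the canonical image of the target: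
it is weak-star continuous, so Goldstine's theorem puts its values in the weak-star closure of the
image of the unit ball, which weak compactness keeps inside the canonical image. -/
theorem IsWeaklyCompactOperator.exists_inclusion_eq {T : E →L[𝕜] F}
    (hT : IsWeaklyCompactOperator T) (φ : StrongDual 𝕜 (StrongDual 𝕜 E)) :
    ∃ y, inclusionInDoubleDual 𝕜 F y = banachAdjoint (banachAdjoint T) φ := by
  obtain ⟨c, ψ, hψ, rfl⟩ := exists_norm_le_one_smul_eq (𝕜 := 𝕜) φ
  have hmem := (continuous_toWeakDual_banachAdjoint (banachAdjoint T)).continuousOn.image_closure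
    (Set.mem_image_of_mem _ (goldstine hψ))
  rw [Set.image_image, Set.image_image] at hmem
  have := hT.closure_image_inclusion_subset
  rw [Set.image_image, Set.image_image] at this
  obtain ⟨y, -, hy⟩ := this hmem
  refine ⟨c • (toWeakSpace 𝕜 F).symm y, ?_⟩
  rw [map_smul, map_smul]
  exact congrArg (c • ·) hy

/-- If the bidual map of `T` takes values in the canonical image of `F`, then the adjoint of `T` is
continuous from the weak-star topology to the weak topology. -/
theorem continuous_toWeakSpace_banachAdjoint {T : E →L[𝕜] F}
    (hT : ∀ φ, ∃ y, inclusionInDoubleDual 𝕜 F y = banachAdjoint (banachAdjoint T) φ) :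
    Continuous fun g : WeakDual 𝕜 F =>
      toWeakSpace 𝕜 (StrongDual 𝕜 E) (banachAdjoint T (WeakDual.toStrongDual g)) := by
  refine WeakBilin.continuous_of_continuous_eval _ fun φ => ?_
  obtain ⟨y, hy⟩ := hT φ
  refine (WeakDual.eval_continuous y).congr fun g => ?_
  exact DFunLike.congr_fun hy (WeakDual.toStrongDual g)

/-- One half of **Gantmacher's theorem**: the adjoint of a weakly compact operator is weakly
compact. -/
theorem IsWeaklyCompactOperator.banachAdjoint {T : E →L[𝕜] F}
    (hT : IsWeaklyCompactOperator T) : IsWeaklyCompactOperator (banachAdjoint T) := by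
  have := (WeakDual.isCompact_closedBall (𝕜 := 𝕜) (E := F) 0 1).image
    (continuous_toWeakSpace_banachAdjoint hT.exists_inclusion_eq)
  refine this.closure_of_subset ?_
  rintro _ ⟨_, ⟨g, hg, rfl⟩, rfl⟩
  exact ⟨StrongDual.toWeakDual g, hg, rfl⟩

/-- The other half of **Gantmacher's theorem**: an operator into a Banach space is weakly compact if
its adjoint is. -/
theorem IsWeaklyCompactOperator.of_banachAdjoint [CompleteSpace F] {T : E →L[𝕜] F}
    (hT : IsWeaklyCompactOperator (_root_.banachAdjoint T)) : IsWeaklyCompactOperator T := by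
  have hw := LinearIsometry.isClosed_toWeakSpace_image_range
    (𝕜 := 𝕜) (E := F) (F := StrongDual 𝕜 (StrongDual 𝕜 F)) (inclusionInDoubleDualLi (E := F) 𝕜)
  -- By weak-star-to-weak continuity of the bidual map and Goldstine's theorem, its values on the
  -- unit ball lie in the weakly closed canonical image of `F`.
  have key : ∀ ψ : StrongDual 𝕜 (StrongDual 𝕜 E), ‖ψ‖ ≤ 1 →
      ∃ y, inclusionInDoubleDual 𝕜 F y = _root_.banachAdjoint (_root_.banachAdjoint T) ψ := by
    intro ψ hψ
    have hmem := (continuous_toWeakSpace_banachAdjoint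
      hT.exists_inclusion_eq).continuousOn.image_closure (Set.mem_image_of_mem _ (goldstine hψ))
    obtain ⟨_, ⟨y, rfl⟩, hy⟩ := closure_minimal (by
      rintro _ ⟨_, ⟨_, ⟨x, -, rfl⟩, rfl⟩, rfl⟩
      exact ⟨_, ⟨T x, rfl⟩, rfl⟩) hw hmem
    exact ⟨y, (toWeakSpace 𝕜 _).injective hy⟩
  refine isCompact_closure_of_isBounded 𝕜 F _
    (((ContinuousLinearMap.lipschitz T).isBounded_image isBounded_closedBall).subset
      (Set.preimage_image_eq _ (toWeakSpace 𝕜 F).injective).subset) ?_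
  -- The weak-star compact image of the unit ball of the bidual contains the canonical
  -- image of `T '' closedBall 0 1`.
  refine (closure_minimal (t := (fun φ : WeakDual 𝕜 (StrongDual 𝕜 E) => StrongDual.toWeakDual
    (_root_.banachAdjoint (_root_.banachAdjoint T) (WeakDual.toStrongDual φ))) ''
      (WeakDual.toStrongDual ⁻¹' closedBall 0 1)) ?_ ?_).trans ?_
  · rintro _ ⟨_, ⟨_, ⟨x, hx, rfl⟩, rfl⟩, rfl⟩
    refine ⟨StrongDual.toWeakDual (inclusionInDoubleDual 𝕜 E x), ?_, rfl⟩
    exact WeakDual.toStrongDual_mem_closedBall.2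
      ((double_dual_bound 𝕜 E x).trans (mem_closedBall_zero_iff.1 hx))
  · exact ((WeakDual.isCompact_closedBall 0 1).image
      (continuous_toWeakDual_banachAdjoint (_root_.banachAdjoint T))).isClosed
  · rintro _ ⟨ψ, hψ, rfl⟩
    obtain ⟨y, hy⟩ := key (WeakDual.toStrongDual ψ) (WeakDual.toStrongDual_mem_closedBall.1 hψ)
    exact ⟨toWeakSpace 𝕜 F y, congrArg StrongDual.toWeakDual hy⟩

end Gantmacher

/-! ### Eberlein's theorem -/

section Eberlein

variable {𝕜 : Type*} [RCLike 𝕜] {E : Type*} [NormedAddCommGroup E] [NormedSpace 𝕜 E]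
variable {H : Type*} [NormedAddCommGroup H] [NormedSpace 𝕜 H]

open NormedSpace Metric

theorem Submodule.isCompact_unit_sphere (V : Submodule 𝕜 E) [FiniteDimensional 𝕜 V] :
    IsCompact {x | x ∈ V ∧ ‖x‖ = 1} := by
  have : ProperSpace V := FiniteDimensional.proper_rclike 𝕜 V
  convert (isCompact_sphere (0 : V) 1).image continuous_subtype_val using 1
  ext x
  simp [and_comm]

/-- A finite-dimensional space of functionals is `2`-normed by finitely many vectors of the unit
ball: for each `x` in the ball, the functionals `ψ` with `‖ψ x‖ > 1 / 2` form an open set, and these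
sets cover the compact unit sphere. -/
theorem exists_finset_norming (V : Submodule 𝕜 (StrongDual 𝕜 E)) [FiniteDimensional 𝕜 V] :
    ∃ N : Finset E, (∀ x ∈ N, ‖x‖ ≤ 1) ∧
      ∀ ψ ∈ V, ∀ c : ℝ, 0 ≤ c → (∀ x ∈ N, ‖ψ x‖ ≤ c) → ‖ψ‖ ≤ 2 * c := by
  obtain ⟨N, hN, hcov⟩ := V.isCompact_unit_sphere.elim_finite_subcover_image
    (b := closedBall (0 : E) 1) (c := fun x => {ψ : StrongDual 𝕜 E | 1 / 2 < ‖ψ x‖})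
    (fun x _ => isOpen_lt continuous_const
      (ContinuousLinearMap.apply 𝕜 𝕜 x).continuous.norm)
    (by
      rintro ψ ⟨-, hψ⟩
      by_contra hcon
      simp only [Set.mem_iUnion, Set.mem_ofPred_eq, not_exists, not_lt] at hcon
      have : ‖ψ‖ ≤ 1 / 2 :=
        ContinuousLinearMap.opNorm_le_of_unit_norm (by norm_num) fun x hx =>
          hcon x (by simp [hx])
      linarith)
  obtain ⟨hN1, hN2⟩ := hcov
  refine ⟨hN1.toFinset, fun x hx => by simpa using hN (hN1.mem_toFinset.1 hx), ?_⟩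
  intro ψ hψ c hc0 hc
  rcases eq_or_ne ψ 0 with rfl | h0
  · simpa using hc0
  have hr : 0 < ‖ψ‖ := norm_pos_iff.2 h0
  have hmem : ((‖ψ‖ : ℝ) : 𝕜)⁻¹ • ψ ∈ {ψ | ψ ∈ V ∧ ‖ψ‖ = 1} := by
    refine ⟨V.smul_mem _ hψ, ?_⟩
    rw [norm_smul, norm_inv, RCLike.norm_ofReal, abs_norm]
    exact inv_mul_cancel₀ hr.ne'
  obtain ⟨x, hx, hlt⟩ := Set.mem_iUnion₂.1 (hN2 hmem)
  have h1 := hc x (hN1.mem_toFinset.2 hx)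
  have h2 : 1 / 2 < ‖ψ‖⁻¹ * ‖ψ x‖ := by
    simpa [norm_smul] using hlt
  rw [inv_mul_eq_div, lt_div_iff₀ hr] at h2
  linarith

theorem WeakSpace.continuous_eval (f : StrongDual 𝕜 E) :
    Continuous fun x : WeakSpace 𝕜 E => f ((toWeakSpace 𝕜 E).symm x) :=
  WeakBilin.eval_continuous (topDualPairing 𝕜 E).flip f

theorem Submodule.mem_closure_of_toWeakSpace_mem_closure {V : Submodule 𝕜 E} {z : WeakSpace 𝕜 E}
    (hz : z ∈ closure (toWeakSpace 𝕜 E '' V)) :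
    (toWeakSpace 𝕜 E).symm z ∈ closure (V : Set E) := by
  let : NormedSpace ℝ E := NormedSpace.restrictScalars ℝ 𝕜 E
  have hconv : Convex ℝ (V : Set E) := (V.restrictScalars ℝ).convex
  rw [← hconv.toWeakSpace_closure 𝕜] at hz
  obtain ⟨x, hx, rfl⟩ := hz
  exact hx

/-- Given a functional `φ` on `H` that is approximated by `J '' S` on finite subsets of `H`, there
is a sequence in `S` whose image converges to `φ` pointwise on a set `D` in the unit ball that is
large enough to `2`-norm the span of `φ` and the image of the sequence. The points of the sequence
and the finite pieces of `D` are chosen alternately. -/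
theorem exists_seq_norming_span (J : E →L[𝕜] StrongDual 𝕜 H) {S : Set E} {φ : StrongDual 𝕜 H}
    (hφ : ∀ (G : Finset H) (n : ℕ), ∃ x ∈ S, ∀ g ∈ G, dist (J x g) (φ g) < 1 / ((n : ℝ) + 1)) :
    ∃ (a : ℕ → E) (D : Set H), (∀ n, a n ∈ S) ∧ (∀ f ∈ D, ‖f‖ ≤ 1) ∧
      (∀ f ∈ D, Tendsto (fun n => J (a n) f) atTop (𝓝 (φ f))) ∧
      ∀ ψ ∈ Submodule.span 𝕜 (insert φ (J '' Set.range a)),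
        ∀ c : ℝ, 0 ≤ c → (∀ f ∈ D, ‖ψ f‖ ≤ c) → ‖ψ‖ ≤ 2 * c := by
  classical
  have hfin (s : Finset E) : FiniteDimensional 𝕜
      (Submodule.span 𝕜 (insert φ (J '' (s : Set E)))) :=
    FiniteDimensional.span_of_finite 𝕜 ((s.finite_toSet.image _).insert φ)
  have hnorming (s : Finset E) := exists_finset_norming
    (Submodule.span 𝕜 (insert φ (J '' (s : Set E))))
  choose x hxS hxG using hφ
  choose N hN1 hN2 using hnorming
  -- `(P k).1`: the points chosen so far; `(P k).2`: where the next point has to approximate `φ`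
  let P : ℕ → Finset E × Finset H := fun n =>
    Nat.rec (∅, N ∅) (fun k Q => (insert (x Q.2 k) Q.1, Q.2 ∪ N (insert (x Q.2 k) Q.1))) n
  have hP (k : ℕ) : P (k + 1) = (insert (x (P k).2 k) (P k).1,
    (P k).2 ∪ N (insert (x (P k).2 k) (P k).1)) := rfl
  have hmono1 : Monotone fun k => (P k).1 :=
    monotone_nat_of_le_succ fun k => by simp only [hP]; exact Finset.subset_insert _ _
  have hmono2 : Monotone fun k => (P k).2 :=
    monotone_nat_of_le_succ fun k => by simp only [hP]; exact Finset.subset_union_left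
  have hNP (k : ℕ) : N (P k).1 ⊆ (P k).2 := by
    cases k with
    | zero => exact subset_rfl
    | succ k => rw [hP]; exact Finset.subset_union_right
  have hP1 (k : ℕ) : ∀ f ∈ (P k).2, ‖f‖ ≤ 1 := by
    induction k with
    | zero => exact hN1 ∅
    | succ k ih =>
      intro f hf
      rw [hP] at hf
      rcases Finset.mem_union.1 hf with hf | hf
      · exact ih f hf
      · exact hN1 _ f hf
  refine ⟨fun k => x (P k).2 k, {f | ∃ k, f ∈ (P k).2}, fun k => hxS _ _,
    fun f ⟨k, hk⟩ => hP1 k f hk, ?_, ?_⟩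
  · rintro f ⟨k, hk⟩
    refine tendsto_iff_dist_tendsto_zero.2 <|
      squeeze_zero' (Eventually.of_forall fun _ => dist_nonneg) ?_
        tendsto_one_div_add_atTop_nhds_zero_nat
    filter_upwards [eventually_ge_atTop k] with n hn
    exact (hxG _ n f (hmono2 hn hk)).le
  · intro ψ hψ c hc0 hc
    let V : ℕ → Submodule 𝕜 (StrongDual 𝕜 H) := fun k =>
      Submodule.span 𝕜 (insert φ (J '' ((P k).1 : Set E)))
    have hV : Monotone V := fun k l hkl => Submodule.span_mono <|
      Set.insert_subset_insert <| Set.image_mono <| Finset.coe_subset.2 (hmono1 hkl)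
    have hle : Submodule.span 𝕜
        (insert φ (J '' Set.range fun k => x (P k).2 k)) ≤ ⨆ k, V k := by
      refine Submodule.span_le.2 (Set.insert_subset ?_ ?_)
      · exact Submodule.mem_iSup_of_mem 0 (Submodule.subset_span (Set.mem_insert _ _))
      · rintro _ ⟨_, ⟨k, rfl⟩, rfl⟩
        refine Submodule.mem_iSup_of_mem (k + 1)
          (Submodule.subset_span (Set.mem_insert_of_mem _ ?_))
        exact Set.mem_image_of_mem _ (Finset.mem_coe.2 (Finset.mem_insert_self _ _))
    obtain ⟨k, hk⟩ := (Submodule.mem_iSup_of_directed V hV.directed_le).1 (hle hψ)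
    exact hN2 _ ψ hk c hc0 fun f hf => hc f ⟨k, hNP k hf⟩

/-- Whitley's argument: if every sequence in `S` has a cluster point, pointwise on `H`, in its own
closed linear span, then every functional that is approximated by `J '' S` on finite sets belongs
to the range of `J`. A cluster point of the sequence of `exists_seq_norming_span` agrees with `φ`
on the set `D`, and `D` norms the difference. -/
theorem exists_eq_of_mapClusterPt (J : E →L[𝕜] StrongDual 𝕜 H) {S : Set E} {φ : StrongDual 𝕜 H}
    (hφ : ∀ (G : Finset H) (n : ℕ), ∃ x ∈ S, ∀ g ∈ G, dist (J x g) (φ g) < 1 / ((n : ℝ) + 1))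
    (hS : ∀ a : ℕ → E, (∀ n, a n ∈ S) → ∃ y ∈ closure (Submodule.span 𝕜 (Set.range a) : Set E),
      ∀ g, MapClusterPt (J y g) atTop fun n => J (a n) g) :
    ∃ y, J y = φ := by
  obtain ⟨a, D, haS, hD1, hDlim, hDnorm⟩ := exists_seq_norming_span J hφ
  obtain ⟨y, hy, hcl⟩ := hS a haS
  have hD : ∀ f ∈ D, J y f = φ f := fun f hf =>
    have h : ClusterPt (J y f) (𝓝 (φ f)) := ClusterPt.mono (hcl f) (hDlim f hf)
    eq_of_nhds_neBot h
  refine ⟨y, (sub_eq_zero.1 (norm_le_zero_iff.1 ?_)).symm⟩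
  -- `φ - J y` may lie outside the span normed by `D`, so it is compared with `φ - J w` for `w` in
  -- the span of the sequence and close to `y`
  refine le_of_forall_pos_le_add fun ε hε => ?_
  obtain ⟨w, hw, hyw⟩ := Metric.mem_closure_iff.1 hy (ε / 3 / (‖J‖ + 1)) (by positivity)
  rw [dist_eq_norm] at hyw
  have hJyw : ‖J (y - w)‖ ≤ ε / 3 := by
    rw [lt_div_iff₀ (by positivity)] at hyw
    refine (J.le_opNorm _).trans ?_
    nlinarith [norm_nonneg (y - w)]
  have hJw : J w ∈ Submodule.span 𝕜 (insert φ (J '' Set.range a)) := by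
    have : J w ∈ (Submodule.span 𝕜 (Set.range a)).map J.toLinearMap := ⟨w, hw, rfl⟩
    rw [Submodule.map_span] at this
    exact Submodule.span_mono (Set.subset_insert _ _) this
  have hbound : ‖φ - J w‖ ≤ 2 * (ε / 3) := by
    refine hDnorm _ (Submodule.sub_mem _ (Submodule.subset_span (Set.mem_insert _ _)) hJw) _
      (by positivity) fun f hf => ?_
    have : (φ - J w) f = J (y - w) f := by
      rw [map_sub, sub_apply, sub_apply, hD f hf]
    rw [this]
    exact ((J (y - w)).le_of_opNorm_le_of_le hJyw (hD1 f hf)).trans_eq (mul_one _)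
  calc ‖φ - J y‖ = ‖(φ - J w) - J (y - w)‖ := by rw [map_sub]; congr 1; abel
    _ ≤ ‖φ - J w‖ + ‖J (y - w)‖ := norm_sub_le _ _
    _ ≤ 2 * (ε / 3) + ε / 3 := add_le_add hbound hJyw
    _ = 0 + ε := by ring

/-- **Eberlein's theorem**: a bounded set is relatively weakly compact if each of its sequences
has a weak cluster point in the space. -/
theorem isRelWeaklyCompact_of_mapClusterPt {S : Set E} (hb : Bornology.IsBounded S)
    (hS : ∀ a : ℕ → E, (∀ n, a n ∈ S) → ∃ z, MapClusterPt z atTop fun n => toWeakSpace 𝕜 E (a n)) :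
    IsRelWeaklyCompact 𝕜 S := by
  refine isCompact_closure_of_isBounded 𝕜 E _
    (hb.subset (Set.preimage_image_eq _ (toWeakSpace 𝕜 E).injective).subset) ?_
  intro φ hφ
  obtain ⟨y, hy⟩ := exists_eq_of_mapClusterPt (inclusionInDoubleDual 𝕜 E) (S := S)
    (φ := WeakDual.toStrongDual φ) (fun G n => by
      have hnhds : ∀ᶠ ψ : WeakDual 𝕜 (StrongDual 𝕜 E) in 𝓝 φ,
          ∀ g ∈ G, dist (ψ g) (φ g) < 1 / ((n : ℝ) + 1) :=
        (Filter.eventually_all_finset G).2 fun g _ =>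
          (WeakDual.eval_continuous g).continuousAt.eventually
            (ball_mem_nhds _ Nat.one_div_pos_of_nat)
      obtain ⟨_, ⟨_, ⟨x, hx, rfl⟩, rfl⟩, hxG⟩ :=
        ((mem_closure_iff_frequently.1 hφ).and_eventually hnhds).exists
      exact ⟨x, hx, hxG⟩) (fun a ha => by
      obtain ⟨z, hz⟩ := hS a ha
      refine ⟨(toWeakSpace 𝕜 E).symm z, Submodule.mem_closure_of_toWeakSpace_mem_closure
        (mem_closure_iff_clusterPt.2 (ClusterPt.mono hz ?_)),
        fun g => hz.continuousAt_comp (WeakSpace.continuous_eval g).continuousAt⟩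
      exact le_principal_iff.2 <| mem_map.2 <| univ_mem' fun n =>
        ⟨a n, Submodule.subset_span ⟨n, rfl⟩, rfl⟩)
  exact ⟨toWeakSpace 𝕜 E y, congrArg StrongDual.toWeakDual hy⟩

end Eberlein

/-! ### Properties of sets determined by sequences -/

section SequentialDetermination

variable {𝕜 : Type*} [RCLike 𝕜] {E : Type*} [NormedAddCommGroup E] [NormedSpace 𝕜 E]

theorem IsWeaklyPrecompact.mono {S S' : Set E} (hS' : IsWeaklyPrecompact 𝕜 S') (h : S ⊆ S') :
    IsWeaklyPrecompact 𝕜 S :=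
  fun x hx => hS' x fun n => h (hx n)

theorem isWeaklyPrecompact_of_range {S : Set E}
    (h : ∀ x : ℕ → E, (∀ n, x n ∈ S) → IsWeaklyPrecompact 𝕜 (Set.range x)) :
    IsWeaklyPrecompact 𝕜 S :=
  fun x hx => h x hx x Set.mem_range_self

theorem IsRelWeaklyCompact.mono {S S' : Set E} (hS' : IsRelWeaklyCompact 𝕜 S') (h : S ⊆ S') :
    IsRelWeaklyCompact 𝕜 S :=
  IsCompact.of_isClosed_subset hS' isClosed_closure (closure_mono (Set.image_mono h))

theorem IsRelCompact.mono {S S' : Set E} (hS' : IsRelCompact S') (h : S ⊆ S') :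
    IsRelCompact S :=
  IsCompact.of_isClosed_subset hS' isClosed_closure (closure_mono h)

/-- Relative weak compactness is determined by sequences, by Eberlein's theorem. -/
theorem isRelWeaklyCompact_of_range {S : Set E} (hb : Bornology.IsBounded S)
    (h : ∀ x : ℕ → E, (∀ n, x n ∈ S) → IsRelWeaklyCompact 𝕜 (Set.range x)) :
    IsRelWeaklyCompact 𝕜 S :=
  isRelWeaklyCompact_of_mapClusterPt hb fun a ha =>
    have ⟨z, _, hz⟩ := IsCompact.exists_mapClusterPt (h a ha) (f := atTop)
      (u := fun n => toWeakSpace 𝕜 E (a n)) <| le_principal_iff.2 <| mem_map.2 <|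
        univ_mem' fun n => subset_closure ⟨a n, ⟨n, rfl⟩, rfl⟩
    ⟨z, hz⟩

theorem isRelCompact_of_range {S : Set E}
    (h : ∀ x : ℕ → E, (∀ n, x n ∈ S) → IsRelCompact (Set.range x)) : IsRelCompact S := by
  refine IsSeqCompact.isCompact fun x hx => ?_
  have happrox (n : ℕ) : ∃ y ∈ S, dist (x n) y < 1 / ((n : ℝ) + 1) :=
    Metric.mem_closure_iff.1 (hx n) _ Nat.one_div_pos_of_nat
  choose y hyS hxy using happrox
  obtain ⟨z, hz, φ, hφ, hlim⟩ :=
    IsCompact.tendsto_subseq (h y hyS) fun n => subset_closure (Set.mem_range_self n)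
  refine ⟨z, closure_mono (Set.range_subset_iff.2 hyS) hz, φ, hφ, ?_⟩
  have hdist : Tendsto (fun n => dist (x n) (y n)) atTop (𝓝 0) :=
    squeeze_zero (fun _ => dist_nonneg) (fun n => (hxy n).le)
      tendsto_one_div_add_atTop_nhds_zero_nat
  refine (tendsto_iff_of_dist ?_).2 hlim
  exact hdist.comp hφ.tendsto_atTop

end SequentialDetermination

/-! ### Weakly-`p`-`L`-sets and `p`-convergent operators -/

section PConvergent

variable {𝕜 : Type*} [RCLike 𝕜] {X : Type*} [NormedAddCommGroup X] [NormedSpace 𝕜 X]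
variable {Y : Type*} [NormedAddCommGroup Y] [NormedSpace 𝕜 Y] {p : ℝ≥0∞}

theorem IsPConvergent.isWeaklyPLSet {T : X →L[𝕜] Y} (hT : IsPConvergent p T) :
    IsWeaklyPLSet p (banachAdjoint T '' Metric.closedBall 0 1) := by
  refine ⟨(banachAdjoint T).lipschitz.isBounded_image Metric.isBounded_closedBall, fun x hx => ?_⟩
  refine squeeze_zero (fun n => Real.iSup_nonneg fun _ => norm_nonneg _) (fun n => ?_)
    (tendsto_zero_iff_norm_tendsto_zero.1 (hT x hx))
  refine Real.iSup_le ?_ (norm_nonneg _)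
  rintro ⟨_, g, hg, rfl⟩
  exact (g.le_of_opNorm_le (mem_closedBall_zero_iff.1 hg) _).trans_eq (one_mul _)

/-- The operator `x ↦ (f k x)ₖ` into `ℓ_∞` given by a sequence `f` of functionals bounded in norm
by `C`. -/
noncomputable def lpInftyOfBounded (f : ℕ → StrongDual 𝕜 X) (C : ℝ) (hf : ∀ k, ‖f k‖ ≤ C) :
    X →L[𝕜] lp (fun _ : ℕ => 𝕜) ∞ :=
  LinearMap.mkContinuous
    { toFun := fun x => ⟨fun k => f k x, memℓp_infty
        ⟨C * ‖x‖, Set.forall_mem_range.2 fun k => (f k).le_of_opNorm_le (hf k) x⟩⟩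
      map_add' := fun x y => by ext k; exact map_add (f k) x y
      map_smul' := fun c x => by ext k; exact map_smul (f k) c x } C fun x =>
    lp.norm_le_of_forall_le (mul_nonneg ((norm_nonneg _).trans (hf 0)) (norm_nonneg x))
      fun k => (f k).le_of_opNorm_le (hf k) x

/-- The adjoint of `lpInftyOfBounded f C hf` maps the `k`-th coordinate functional to `f k`. -/
theorem range_subset_banachAdjoint_lpInftyOfBounded (f : ℕ → StrongDual 𝕜 X) (C : ℝ)
    (hf : ∀ k, ‖f k‖ ≤ C) :
    Set.range f ⊆ banachAdjoint (lpInftyOfBounded f C hf) '' Metric.closedBall 0 1 := by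
  rintro _ ⟨k, rfl⟩
  refine ⟨lp.evalCLM 𝕜 (fun _ : ℕ => 𝕜) ∞ k, mem_closedBall_zero_iff.2 ?_, rfl⟩
  refine ContinuousLinearMap.opNorm_le_bound _ zero_le_one fun x => ?_
  rw [one_mul]
  exact lp.norm_apply_le_norm ENNReal.top_ne_zero x k

theorem IsWeaklyPLSet.isPConvergent_lpInftyOfBounded {A : Set (StrongDual 𝕜 X)}
    (hA : IsWeaklyPLSet p A) {f : ℕ → StrongDual 𝕜 X} (hfA : ∀ k, f k ∈ A) {C : ℝ}
    (hf : ∀ k, ‖f k‖ ≤ C) : IsPConvergent p (lpInftyOfBounded f C hf) := by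
  intro x hx
  refine squeeze_zero_norm (fun n => ?_) (hA.2 x hx)
  obtain ⟨R, hR⟩ := isBounded_iff_forall_norm_le.1 hA.1
  have hbdd : BddAbove (Set.range fun g : A => ‖(g : StrongDual 𝕜 X) (x n)‖) :=
    ⟨R * ‖x n‖, Set.forall_mem_range.2 fun g => g.1.le_of_opNorm_le (hR g g.2) _⟩
  exact lp.norm_le_of_forall_le (Real.iSup_nonneg fun _ => norm_nonneg _) fun k =>
    le_ciSup hbdd ⟨f k, hfA k⟩

/-- A hereditary property of sets of functionals that is determined by sequences holds for every
weakly-`p`-`L`-set once it holds for the image of the dual ball under the adjoint of every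
`p`-convergent operator into `ℓ_∞`. -/
theorem IsWeaklyPLSet.of_forall_lpInfty {P : Set (StrongDual 𝕜 X) → Prop}
    (hmono : ∀ S S', P S' → S ⊆ S' → P S)
    (hrange : ∀ S, Bornology.IsBounded S →
      (∀ f : ℕ → StrongDual 𝕜 X, (∀ n, f n ∈ S) → P (Set.range f)) → P S)
    (h : ∀ T : X →L[𝕜] lp (fun _ : ℕ => 𝕜) ∞, IsPConvergent p T →
      P (banachAdjoint T '' Metric.closedBall 0 1))
    {A : Set (StrongDual 𝕜 X)} (hA : IsWeaklyPLSet p A) : P A := by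
  obtain ⟨C, hC⟩ := isBounded_iff_forall_norm_le.1 hA.1
  exact hrange A hA.1 fun f hf => hmono _ _
    (h _ (hA.isPConvergent_lpInftyOfBounded hf fun k => hC _ (hf k)))
    (range_subset_banachAdjoint_lpInftyOfBounded f C _)

theorem isCompactOperator_banachAdjoint_iff {T : X →L[𝕜] Y} :
    IsCompactOperator (banachAdjoint T) ↔
      IsRelCompact (banachAdjoint T '' Metric.closedBall 0 1) :=
  isCompactOperator_iff_isCompact_closure_image_closedBall (banachAdjoint T).toLinearMap one_pos

theorem IsPConvergent.clm_comp {Z : Type*} [NormedAddCommGroup Z] [NormedSpace 𝕜 Z]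
    {T : X →L[𝕜] Y} (hT : IsPConvergent p T) (U : Y →L[𝕜] Z) : IsPConvergent p (U.comp T) :=
  fun x hx => (U.continuous.tendsto' 0 0 (map_zero U)).comp (hT x hx)

/-- The image of the dual ball under the adjoint does not shrink when the target is replaced by an
isometric copy. -/
theorem banachAdjoint_image_closedBall_subset {Z : Type*} [NormedAddCommGroup Z]
    [NormedSpace 𝕜 Z] (T : X →L[𝕜] Y) (e : Z ≃ₗᵢ[𝕜] Y) :
    banachAdjoint T '' Metric.closedBall 0 1 ⊆
      banachAdjoint ((e.symm : Y →L[𝕜] Z).comp T) '' Metric.closedBall 0 1 := by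
  rintro _ ⟨g, hg, rfl⟩
  refine ⟨g.comp (e : Z →L[𝕜] Y), mem_closedBall_zero_iff.2 ?_, ?_⟩
  · refine ContinuousLinearMap.opNorm_le_bound _ zero_le_one fun z => ?_
    exact (g.le_of_opNorm_le (mem_closedBall_zero_iff.1 hg) _).trans_eq
      (by simp)
  · ext x
    simp [banachAdjoint_apply]

/-- The common form of the three equivalences, for a hereditary property `P` determined by
sequences. The target spaces `Y` live in an arbitrary universe, which is reached from `ℓ_∞` by
`ULift`. -/
theorem tfae_weaklyPLSet {𝕜 : Type} [RCLike 𝕜] {X : Type u} [NormedAddCommGroup X]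
    [NormedSpace 𝕜 X] {p : ℝ≥0∞} {P : Set (StrongDual 𝕜 X) → Prop}
    (hmono : ∀ S S', P S' → S ⊆ S' → P S)
    (hrange : ∀ S, Bornology.IsBounded S →
      (∀ f : ℕ → StrongDual 𝕜 X, (∀ n, f n ∈ S) → P (Set.range f)) → P S) :
    List.TFAE
      [∀ (Y : Type v) [NormedAddCommGroup Y] [NormedSpace 𝕜 Y] [CompleteSpace Y] (T : X →L[𝕜] Y),
          IsPConvergent p T → P (banachAdjoint T '' Metric.closedBall 0 1),
        ∀ T : X →L[𝕜] lp (fun _ : ℕ => 𝕜) ∞,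
          IsPConvergent p T → P (banachAdjoint T '' Metric.closedBall 0 1),
        ∀ A : Set (StrongDual 𝕜 X), IsWeaklyPLSet p A → P A] := by
  tfae_have 1 → 2 := by
    intro h T hT
    let e : ULift.{v} (lp (fun _ : ℕ => 𝕜) ∞) ≃ₗᵢ[𝕜] lp (fun _ : ℕ => 𝕜) ∞ :=
      LinearIsometryEquiv.ulift 𝕜 _
    exact hmono _ _ (h _ _ (hT.clm_comp _)) (banachAdjoint_image_closedBall_subset T e)
  tfae_have 2 → 3 := fun h A hA => hA.of_forall_lpInfty hmono hrange h
  tfae_have 3 → 1 := fun h Y _ _ _ T hT => h _ hT.isWeaklyPLSet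
  tfae_finish

end PConvergent

theorem mainTheorem4 {𝕜 : Type} [RCLike 𝕜] (p : ℝ≥0∞) (hp1 : 1 ≤ p) (hp2 : p < ∞)
    (X : Type u) [NormedAddCommGroup X] [NormedSpace 𝕜 X] [CompleteSpace X] :
    -- the weakly precompact case
    List.TFAE
      [∀ (Y : Type v) [NormedAddCommGroup Y] [NormedSpace 𝕜 Y] [CompleteSpace Y] (T : X →L[𝕜] Y),
          IsPConvergent p T → IsWeaklyPrecompactOperator (banachAdjoint T),
        ∀ T : X →L[𝕜] lp (fun _ : ℕ => 𝕜) ∞,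
          IsPConvergent p T → IsWeaklyPrecompactOperator (banachAdjoint T),
        ∀ A : Set (StrongDual 𝕜 X), IsWeaklyPLSet p A → IsWeaklyPrecompact 𝕜 A] ∧
    -- the weakly compact case
    List.TFAE
      [∀ (Y : Type v) [NormedAddCommGroup Y] [NormedSpace 𝕜 Y] [CompleteSpace Y] (T : X →L[𝕜] Y),
          IsPConvergent p T → IsWeaklyCompactOperator (banachAdjoint T),
        ∀ T : X →L[𝕜] lp (fun _ : ℕ => 𝕜) ∞,
          IsPConvergent p T → IsWeaklyCompactOperator (banachAdjoint T),
        ∀ A : Set (StrongDual 𝕜 X), IsWeaklyPLSet p A → IsRelWeaklyCompact 𝕜 A] ∧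
    -- the compact case
    List.TFAE
      [∀ (Y : Type v) [NormedAddCommGroup Y] [NormedSpace 𝕜 Y] [CompleteSpace Y] (T : X →L[𝕜] Y),
          IsPConvergent p T → IsCompactOperator (banachAdjoint T),
        ∀ T : X →L[𝕜] lp (fun _ : ℕ => 𝕜) ∞,
          IsPConvergent p T → IsCompactOperator (banachAdjoint T),
        ∀ A : Set (StrongDual 𝕜 X), IsWeaklyPLSet p A → IsRelCompact A] ∧
    -- the characterization of the reciprocal Dunford-Pettis property of order `p`
    (HasRDP 𝕜 X p ↔
      ∀ (Y : Type v) [NormedAddCommGroup Y] [NormedSpace 𝕜 Y] [CompleteSpace Y] (T : X →L[𝕜] Y),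
        IsPConvergent p T → IsWeaklyCompactOperator T) := by
  have hweak := tfae_weaklyPLSet.{u, v} (p := p) (P := IsRelWeaklyCompact 𝕜 (E := StrongDual 𝕜 X))
    (fun _ _ => IsRelWeaklyCompact.mono) (fun _ => isRelWeaklyCompact_of_range)
  refine ⟨tfae_weaklyPLSet (P := IsWeaklyPrecompact 𝕜) (fun _ _ => IsWeaklyPrecompact.mono)
    (fun _ _ => isWeaklyPrecompact_of_range), hweak, ?_, ?_⟩
  · simp_rw [isCompactOperator_banachAdjoint_iff]
    exact tfae_weaklyPLSet (P := IsRelCompact) (fun _ _ => IsRelCompact.mono)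
      (fun _ _ => isRelCompact_of_range)
  · refine (hweak.out 2 0).trans ⟨?_, ?_⟩
    · intro h Y _ _ _ T hT
      exact IsWeaklyCompactOperator.of_banachAdjoint (h Y T hT)
    · intro h Y _ _ _ T hT
      exact (h Y T hT).banachAdjoint
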